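/- Let $\mathbb{D}$ be the open unit disc, let $H^2$ be the Hardy space of functions $f(z)=\sum_{n\ge 0}c_nz^n$ on $\mathbb{D}$ with $\|f\|^2=\sum_{n\ge 0}|c_n|^2<\infty$, and let $\varphi\colon\mathbb{D}\to\mathbb{D}$ be analytic. A weight is a function $w\in H^2$ with $w\not\equiv 0$, and $M_wC_\varphi$ denotes the weighted composition operator $f\mapsto w\cdot(f\circ\varphi)$. A bounded operator $T$ on $H^2$ belongs to the Schatten class $S_p$, $0<p<\infty$, if it is compact and $\sum_n s_n(T)^p<\infty$, where $(s_n(T))_n$ is the sequence of eigenvalues, repeated according to multiplicity, of $|T|=\sqrt{T^*T}$; the Hilbert--Schmidt operators are the elements of $S_2$. For every $0<p<\infty$: if there is a weight $w$ such that $M_wC_\varphi$ is a bounded operator on $H^2$ that belongs to $S_p$, then there is a weight $\tilde w$ such that $M_{\tilde w}C_\varphi$ is a bounded Hilbert--Schmidt operator on $H^2$. -/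

import Mathlib

open scoped Complex.UnitDisc ENNReal

noncomputable section

namespace HardyWeighted

/-- A complex-valued function on the open unit disc is analytic: it is the restriction to the disc
of a function on `ℂ` that is complex differentiable at every point of the disc. -/
def IsAnalytic (f : 𝔻 → ℂ) : Prop :=
  ∃ F : ℂ → ℂ, DifferentiableOn ℂ F (Metric.ball 0 1) ∧ ∀ z : 𝔻, f z = F (z : ℂ)

/-- The Hilbert space of square summable complex sequences `(c₀, c₁, c₂, …)`. -/
abbrev SqSummable : Type := lp (fun _ : ℕ => ℂ) 2

theorem summable_powerSeries (c : SqSummable) (z : 𝔻) :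
    Summable (fun n : ℕ => c n * (z : ℂ) ^ n) := by
  have hz : ‖(z : ℂ)‖ < 1 := z.norm_lt_one
  refine Summable.of_norm_bounded (g := fun n : ℕ => ‖c‖ * ‖(z : ℂ)‖ ^ n)
    ((summable_geometric_of_lt_one (norm_nonneg _) hz).mul_left _) (fun n => ?_)
  rw [norm_mul, norm_pow]
  exact mul_le_mul_of_nonneg_right (lp.norm_apply_le_norm (by norm_num) c n) (by positivity)

/-- The linear map that sends a square summable sequence `c` to the function
`z ↦ ∑ₙ cₙ zⁿ` on the disc. -/
def powerSeries : SqSummable →ₗ[ℂ] (𝔻 → ℂ) where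
  toFun c := fun z => ∑' n : ℕ, c n * (z : ℂ) ^ n
  map_add' a b := by
    funext z
    simp only [lp.coeFn_add, Pi.add_apply, add_mul]
    exact (summable_powerSeries a z).tsum_add (summable_powerSeries b z)
  map_smul' r a := by
    funext z
    simp only [lp.coeFn_smul, Pi.smul_apply, smul_eq_mul, mul_assoc, RingHom.id_apply]
    exact tsum_mul_left

theorem powerSeries_injective : Function.Injective powerSeries := by
  have key : ∀ c : SqSummable, HasFPowerSeriesOnBall (fun x : ℂ => ∑' n : ℕ, c n * x ^ n)
      (FormalMultilinearSeries.ofScalars ℂ (fun n => c n)) 0 1 := by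
    intro c
    refine ⟨?_, by norm_num, ?_⟩
    · refine FormalMultilinearSeries.le_radius_of_bound _ (C := ‖c‖) (r := 1) (fun n => ?_)
      rw [FormalMultilinearSeries.ofScalars_norm]
      simpa using lp.norm_apply_le_norm (by norm_num) c n
    · intro y hy
      have hy' : ‖y‖ < 1 := by simpa [← ofReal_norm, Metric.eball] using hy
      have hs := (summable_powerSeries c (Complex.UnitDisc.mk y hy')).hasSum
      simpa [FormalMultilinearSeries.ofScalars_apply_eq, mul_comm] using hs
  intro a b hab
  have h : HasFPowerSeriesAt (fun x : ℂ => ∑' n : ℕ, a n * x ^ n)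
      (FormalMultilinearSeries.ofScalars ℂ (fun n => b n)) 0 := by
    refine (key b).hasFPowerSeriesAt.congr ?_
    filter_upwards [Metric.ball_mem_nhds (0 : ℂ) one_pos] with y hy
    exact (congrFun hab (Complex.UnitDisc.mk y (by simpa using hy))).symm
  have h2 := (key a).hasFPowerSeriesAt.eq_formalMultilinearSeries h
  ext n
  have h3 := congrArg (fun p => p.coeff n) h2
  simpa [FormalMultilinearSeries.coeff_ofScalars] using h3

/-- The Hardy space `H²` of the disc: the functions `f : 𝔻 → ℂ` (necessarily analytic) of the form
`f z = ∑ₙ cₙ zⁿ` with `∑ₙ |cₙ|² < ∞`. -/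
def H2 : Type := LinearMap.range powerSeries

namespace H2

instance : CoeFun H2 (fun _ => 𝔻 → ℂ) := ⟨fun f => f.1⟩

instance (priority := low) : AddCommGroup H2 := inferInstanceAs (AddCommGroup (LinearMap.range powerSeries))

instance (priority := low) : Module ℂ H2 := inferInstanceAs (Module ℂ (LinearMap.range powerSeries))

/-- The sequence of Taylor coefficients at `0` of a function in `H²`, as a linear isomorphism
from `H²` onto the space of square summable sequences. -/
def coeffs : H2 ≃ₗ[ℂ] SqSummable :=
  (LinearEquiv.ofInjective powerSeries powerSeries_injective).symm

/-- `H²` carries the norm `‖f‖² = ∑ₙ |cₙ|²`. -/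
instance : NormedAddCommGroup H2 :=
  NormedAddCommGroup.induced H2 SqSummable coeffs coeffs.injective

/-- `H²` carries the inner product that its Taylor coefficients inherit from `ℓ²`. -/
instance : InnerProductSpace ℂ H2 := InnerProductSpace.induced coeffs

theorem coeffs_isometry : Isometry coeffs :=
  AddMonoidHomClass.isometry_of_norm coeffs (fun _ => rfl)

instance : CompleteSpace H2 :=
  (coeffs_isometry.isUniformInducing.completeSpace_congr coeffs.surjective).2 inferInstance

end H2

/-- Membership in the Schatten class `S_p` of a bounded operator `T : H → K` between complex
Hilbert spaces: `T` is compact and `∑ₙ sₙ(T)ᵖ < ∞`, where `sₙ(T)` are the eigenvalues of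
`|T| = √(T* T)`. The sum is grouped by the distinct positive eigenvalues `s` of `|T|`, each counted
with its multiplicity `dim ker (|T| - s)`, which is finite because `T` is compact (a number `s > 0`
that is not an eigenvalue, like the eigenvalue `0`, contributes `0`). -/
def IsSchatten {H K : Type*} [NormedAddCommGroup H] [InnerProductSpace ℂ H] [CompleteSpace H]
    [NormedAddCommGroup K] [InnerProductSpace ℂ K] [CompleteSpace K]
    (p : ℝ) (T : H →L[ℂ] K) : Prop :=
  IsCompactOperator T ∧
    Summable fun s : {s : ℝ // 0 < s} =>
      (Module.finrank ℂ (Module.End.eigenspace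
        ((CFC.sqrt (ContinuousLinearMap.adjoint T ∘L T) : H →L[ℂ] H) : H →ₗ[ℂ] H)
        ((s : ℝ) : ℂ)) : ℝ) * (s : ℝ) ^ p

/-- The Hilbert–Schmidt operators are the Schatten class `S_2`. -/
def IsHilbertSchmidt {H K : Type*} [NormedAddCommGroup H] [InnerProductSpace ℂ H]
    [CompleteSpace H] [NormedAddCommGroup K] [InnerProductSpace ℂ K] [CompleteSpace K]
    (T : H →L[ℂ] K) : Prop :=
  IsSchatten 2 T

/-- `T` is the weighted composition operator `M_w C_φ : f ↦ w · (f ∘ φ)`, as a bounded operator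
on `H²`. -/
def IsWeightedComposition (w : H2) (φ : 𝔻 → 𝔻) (T : H2 →L[ℂ] H2) : Prop :=
  ∀ (f : H2) (z : 𝔻), T f z = w z * f (φ z)

end HardyWeighted

end

/-! ### Hilbert–Schmidt sums, singular values and Schatten classes on Hilbert spaces. -/

noncomputable section

namespace HardyWeighted

open Module.End Filter Topology

/-! Write `T` for the given operator `M_w C_φ`, so that `T zⁿ = w φⁿ`. Membership in `S_p` gives `∑
‖w φⁿ‖^(2k) < ∞` for some integer `k ≥ 2` (`IsSchatten.exists_tsum_enorm_pow_ne_top`). With `β = 1 -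
1/(2k)`, Hölder's inequality turns this into `∑ (n+1)^(-β) ‖w φⁿ‖² < ∞` (`summable_weight_mul`).

Each `|w φⁿ|²` lies below the real part of its Herglotz transform. The weighted sum of these
transforms, plus `1`, is an analytic `F` with `Re F ≥ 1 + ∑ (n+1)^(-β) |w φⁿ|²`
(`exists_analytic_majorant_tsum`). By `rpow_sub_one_le_tsum` the right side is at least `|w|² (1 -
|φ|²)^(-1/(2k))`. Hence `W = (w²/F)^(2k)` is analytic, not identically zero, and satisfies `|W| ≤ 1
- |φ|²`.

For such a `W` one has `∑ |W φⁿ|² ≤ 1 - |φ|² ≤ 1` pointwise. Parseval on circles then bounds the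
Hilbert–Schmidt norm of `M_W C_φ` (`exists_isHilbertSchmidt_of_norm_le`). -/

theorem enorm_sq_eq_ofReal {E : Type*} [NormedAddCommGroup E] (x : E) :
    ‖x‖ₑ ^ 2 = ENNReal.ofReal (‖x‖ ^ 2) := by
  rw [ENNReal.ofReal_pow (norm_nonneg _), ofReal_norm]

section Operators

variable {H K : Type*} [NormedAddCommGroup H] [InnerProductSpace ℂ H]
  [NormedAddCommGroup K] [InnerProductSpace ℂ K]

/-- Parseval's identity in `ℝ≥0∞`. -/
theorem tsum_enorm_inner_sq {ι : Type*} (b : HilbertBasis ι ℂ H) (x : H) :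
    ∑' i, ‖inner ℂ (b i) x‖ₑ ^ 2 = ‖x‖ₑ ^ 2 := by
  have h := lp.hasSum_norm (p := 2) (by norm_num) (b.repr x)
  simp only [LinearIsometryEquiv.norm_map, HilbertBasis.repr_apply_apply,
    ENNReal.toReal_ofNat, Real.rpow_ofNat] at h
  rw [enorm_sq_eq_ofReal, ← h.tsum_eq, ENNReal.ofReal_tsum_of_nonneg (fun _ => by positivity)
    h.summable]
  simp_rw [enorm_sq_eq_ofReal]

/-- Bessel's inequality in `ℝ≥0∞`. -/
theorem tsum_enorm_inner_sq_le {ι : Type*} {v : ι → H} (hv : Orthonormal ℂ v) (x : H) :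
    ∑' i, ‖inner ℂ (v i) x‖ₑ ^ 2 ≤ ‖x‖ₑ ^ 2 := by
  simp_rw [enorm_sq_eq_ofReal]
  rw [← ENNReal.ofReal_tsum_of_nonneg (fun _ => by positivity) (hv.inner_products_summable x)]
  exact ENNReal.ofReal_le_ofReal (hv.tsum_inner_products_le x)

variable [CompleteSpace H] [CompleteSpace K]

/-- Parseval in `b`, an exchange of the two sums, then Bessel for `v`. Applying it to `R` and to its
adjoint removes the dependence on the basis. -/
theorem tsum_enorm_sq_le_adjoint {ι κ : Type*} {v : ι → H} (hv : Orthonormal ℂ v)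
    (b : HilbertBasis κ ℂ K) (R : H →L[ℂ] K) :
    ∑' i, ‖R (v i)‖ₑ ^ 2 ≤ ∑' j, ‖ContinuousLinearMap.adjoint R (b j)‖ₑ ^ 2 := by
  simp_rw [← tsum_enorm_inner_sq b (R _)]
  rw [ENNReal.tsum_comm]
  refine ENNReal.tsum_le_tsum fun j => ?_
  refine le_trans (le_of_eq ?_) (tsum_enorm_inner_sq_le hv _)
  congr 1 with i
  rw [ContinuousLinearMap.adjoint_inner_right, ← enorm_norm, norm_inner_symm, enorm_norm]

/-- The Hilbert-Schmidt norm dominates the sums over orthonormal families. -/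
theorem tsum_enorm_sq_le {ι κ : Type*} {v : ι → H} (hv : Orthonormal ℂ v)
    (b : HilbertBasis κ ℂ H) (R : H →L[ℂ] K) :
    ∑' i, ‖R (v i)‖ₑ ^ 2 ≤ ∑' j, ‖R (b j)‖ₑ ^ 2 := by
  obtain ⟨w, b', -⟩ := exists_hilbertBasis ℂ K
  refine (tsum_enorm_sq_le_adjoint hv b' R).trans ?_
  simpa using tsum_enorm_sq_le_adjoint b'.orthonormal b (ContinuousLinearMap.adjoint R)

/-- A single unit vector is an orthonormal family, so the comparison of sums applies to it. -/
theorem enorm_sq_le_tsum {κ : Type*} (b : HilbertBasis κ ℂ H) (R : H →L[ℂ] K) :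
    ‖R‖ₑ ^ 2 ≤ ∑' j, ‖R (b j)‖ₑ ^ 2 := by
  by_cases htop : ∑' j, ‖R (b j)‖ₑ ^ 2 = ⊤
  · simp [htop]
  set M := ∑' j, ‖R (b j)‖ₑ ^ 2
  have key : ‖R‖ ≤ √M.toReal := by
    refine R.opNorm_le_of_unit_norm (𝕜 := ℂ) (Real.sqrt_nonneg _) fun x hx => ?_
    have hv : Orthonormal ℂ (fun _ : Unit => x) := by
      refine ⟨fun _ => hx, fun i j hij => (hij (Subsingleton.elim _ _)).elim⟩
    have h := tsum_enorm_sq_le hv b R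
    rw [tsum_fintype, Finset.univ_unique, Finset.sum_singleton, enorm_sq_eq_ofReal] at h
    exact Real.le_sqrt_of_sq_le ((ENNReal.ofReal_le_iff_le_toReal htop).1 h)
  rw [enorm_sq_eq_ofReal, ENNReal.ofReal_le_iff_le_toReal htop]
  calc ‖R‖ ^ 2 ≤ √M.toReal ^ 2 := by gcongr
    _ = M.toReal := Real.sq_sqrt ENNReal.toReal_nonneg

/-- The finite-rank truncations converge in norm: the squared error is at most a tail of the
convergent sum. -/
theorem isCompactOperator_of_tsum_ne_top {κ : Type*} (b : HilbertBasis κ ℂ H) (T : H →L[ℂ] K)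
    (hT : ∑' j, ‖T (b j)‖ₑ ^ 2 ≠ ⊤) : IsCompactOperator T := by
  classical
  let F : Finset κ → H →L[ℂ] K := fun s => ∑ j ∈ s, (innerSL ℂ (b j)).smulRight (T (b j))
  have hF : ∀ s, IsCompactOperator (F s) := by
    intro s
    have : F s ∈ compactOperator (RingHom.id ℂ) H K := by
      refine Submodule.sum_mem _ fun j _ => ?_
      have h1 : IsCompactOperator (ContinuousLinearMap.toSpanSingleton ℂ (T (b j))) :=
        isCompactOperator_of_locallyCompactSpace_rng _
      exact h1.comp_clm (innerSL ℂ (b j))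
    exact this
  refine isCompactOperator_of_tendsto (F := F) (l := atTop) ?_ (Eventually.of_forall hF)
  rw [tendsto_iff_norm_sub_tendsto_zero]
  have hle : ∀ s, ‖F s - T‖ₑ ^ 2 ≤ ∑' j : {j // j ∉ s}, ‖T (b j)‖ₑ ^ 2 := by
    intro s
    refine (enorm_sq_le_tsum b _).trans ?_
    rw [← tsum_subtype_eq_of_support_subset (s := {j | j ∉ s})]
    · refine ENNReal.tsum_le_tsum fun j => ?_
      have : F s (b j) = 0 := by
        simp only [F, _root_.sum_apply]
        refine Finset.sum_eq_zero fun i hi => ?_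
        have hij : i ≠ (j : κ) := fun h => j.2 (h ▸ hi)
        simp [b.orthonormal.2 hij]
      simp [this]
    · intro j hj
      by_contra hjs
      simp only [Set.mem_ofPred_eq, not_not] at hjs
      apply hj
      have : F s (b j) = T (b j) := by
        simp only [F, _root_.sum_apply]
        rw [Finset.sum_eq_single j]
        · simp [b.orthonormal.1 j]
        · intro i _ hij
          simp [b.orthonormal.2 hij]
        · exact fun h => (h hjs).elim
      simp [this]
  have h0 := tendsto_of_tendsto_of_tendsto_of_le_of_le tendsto_const_nhds
    (ENNReal.tendsto_tsum_compl_atTop_zero hT) (fun s => zero_le) hle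
  have h1 := (ENNReal.tendsto_toReal ENNReal.zero_ne_top).comp h0
  simpa [Function.comp_def] using h1.sqrt

/-- With `S = |T|` and `S² v = s² v`, the vector `u = S v - s v` satisfies `S u = -s u`, and
positivity of `S` forces `u = 0`. -/
theorem eigenspace_sqrt (T : H →L[ℂ] K) {s : ℝ} (hs : 0 < s) :
    eigenspace ((CFC.sqrt (ContinuousLinearMap.adjoint T ∘L T) : H →L[ℂ] H) : H →ₗ[ℂ] H) (s : ℂ) =
      eigenspace ((ContinuousLinearMap.adjoint T ∘L T : H →L[ℂ] H) : H →ₗ[ℂ] H)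
        ((s ^ 2 : ℝ) : ℂ) := by
  set B := ContinuousLinearMap.adjoint T ∘L T
  have hB : 0 ≤ B := (ContinuousLinearMap.nonneg_iff_isPositive _).2
    (ContinuousLinearMap.isPositive_adjoint_comp_self T)
  have hS := (ContinuousLinearMap.nonneg_iff_isPositive _).1 (CFC.sqrt_nonneg B)
  have hSS := CFC.sqrt_mul_sqrt_self B hB
  set S := CFC.sqrt B
  have hSB : ∀ v, S (S v) = B v := fun v => by rw [← hSS]; rfl
  ext v
  simp only [mem_eigenspace_iff, ContinuousLinearMap.coe_coe]
  constructor
  · intro h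
    rw [← hSB, h, map_smul, h, smul_smul, Complex.ofReal_pow, sq]
  · intro h
    rw [← sub_eq_zero]
    set u := S v - (s : ℂ) • v
    have hu : S u = -((s : ℂ) • u) := by
      simp only [u, map_sub, map_smul, hSB, h, smul_sub, smul_smul, sq,
        Complex.ofReal_mul]
      abel
    have h1 := hS.re_inner_nonneg_left u
    rw [hu, inner_neg_left, inner_smul_left, inner_self_eq_norm_sq_to_K] at h1
    have h2 : 0 ≤ -(s * ‖u‖ ^ 2) := by
      convert h1 using 1
      simp [← Complex.ofReal_pow, ← Complex.ofReal_mul]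
    have h3 : ‖u‖ ^ 2 ≤ 0 := by nlinarith [sq_nonneg ‖u‖]
    exact norm_eq_zero.1 (pow_eq_zero_iff two_ne_zero |>.1 (le_antisymm h3 (sq_nonneg _)))

theorem isCompactOperator_adjoint_comp_self {T : H →L[ℂ] K} (hT : IsCompactOperator T) :
    IsCompactOperator (ContinuousLinearMap.adjoint T ∘L T : H →L[ℂ] H) :=
  hT.clm_comp (ContinuousLinearMap.adjoint T)

theorem norm_apply_of_mem_eigenspace_sqrt (T : H →L[ℂ] K) {s : ℝ} (hs : 0 < s) {v : H}
    (hv : v ∈ eigenspace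
      ((CFC.sqrt (ContinuousLinearMap.adjoint T ∘L T) : H →L[ℂ] H) : H →ₗ[ℂ] H) (s : ℂ)) :
    ‖T v‖ ^ 2 = s ^ 2 * ‖v‖ ^ 2 := by
  rw [eigenspace_sqrt T hs, mem_eigenspace_iff] at hv
  have h : inner ℂ (ContinuousLinearMap.adjoint T (T v)) v = inner ℂ (T v) (T v) :=
    ContinuousLinearMap.adjoint_inner_left T v (T v)
  change ContinuousLinearMap.adjoint T (T v) = _ at hv
  rw [hv, inner_smul_left, inner_self_eq_norm_sq_to_K, inner_self_eq_norm_sq_to_K] at h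
  simp only [Complex.conj_ofReal] at h
  have h' : ((s ^ 2 * ‖v‖ ^ 2 : ℝ) : ℂ) = ((‖T v‖ ^ 2 : ℝ) : ℂ) := by
    push_cast
    simpa using h
  exact (Complex.ofReal_injective h').symm

/-- An operator with finite Hilbert-Schmidt norm is in the Schatten class `S_2`. -/
theorem isHilbertSchmidt_of_tsum_ne_top {κ : Type*} (b : HilbertBasis κ ℂ H) (T : H →L[ℂ] K)
    (hT : ∑' j, ‖T (b j)‖ₑ ^ 2 ≠ ⊤) : IsHilbertSchmidt T := by
  have hc := isCompactOperator_of_tsum_ne_top b T hT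
  refine ⟨hc, ?_⟩
  set S : H →ₗ[ℂ] H := ((CFC.sqrt (ContinuousLinearMap.adjoint T ∘L T) : H →L[ℂ] H) : H →ₗ[ℂ] H)
    with hSdef
  have hfin : ∀ s : {s : ℝ // 0 < s}, FiniteDimensional ℂ (eigenspace S ((s : ℝ) : ℂ)) := by
    intro s
    rw [hSdef, eigenspace_sqrt T s.2]
    exact ContinuousLinearMap.finite_dimensional_eigenspace
      (isCompactOperator_adjoint_comp_self hc) _ (by exact_mod_cast (pow_pos s.2 2).ne')
  have hsymm : S.IsSymmetric := ((ContinuousLinearMap.nonneg_iff_isPositive _).1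
    (CFC.sqrt_nonneg (ContinuousLinearMap.adjoint T ∘L T))).isSymmetric
  -- Orthonormal bases of the eigenspaces of `|T|` form one orthonormal family on which `‖T v‖ = s`.
  -- The Hilbert–Schmidt sum therefore dominates the sum of the `s²` with multiplicity.
  have hOF := hsymm.orthogonalFamily_eigenspaces.comp
    (f := fun s : {s : ℝ // 0 < s} => ((s : ℝ) : ℂ))
    (fun a c h => Subtype.ext (Complex.ofReal_injective h))
  have hon := hOF.orthonormal_sigma_orthonormal
    (v_family := fun s => stdOrthonormalBasis ℂ (eigenspace S ((s : ℝ) : ℂ)))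
    (fun s => (stdOrthonormalBasis ℂ (eigenspace S ((s : ℝ) : ℂ))).orthonormal)
  have hle := tsum_enorm_sq_le hon b T
  rw [ENNReal.tsum_sigma'] at hle
  have hne := ne_top_of_le_ne_top hT hle
  convert ENNReal.summable_toReal hne using 2 with s
  have : ∀ i, ‖T (((stdOrthonormalBasis ℂ (eigenspace S ((s : ℝ) : ℂ))) i : _) : H)‖ₑ ^ 2 =
      ENNReal.ofReal ((s : ℝ) ^ 2) := by
    intro i
    rw [enorm_sq_eq_ofReal, norm_apply_of_mem_eigenspace_sqrt T s.2 (Subtype.mem _),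
      Submodule.norm_coe, (stdOrthonormalBasis ℂ _).orthonormal.1 i]
    simp
  simp [this, ENNReal.toReal_mul, ENNReal.toReal_ofReal (sq_nonneg _)]

/-- For self-adjoint `C`, `‖C e‖² = ⟨C² e, e⟩ ≤ ‖C² e‖`; iterating this doubles the exponent, hence
the powers of two. -/
theorem norm_pow_two_pow_le {B : H →L[ℂ] H} (hB : IsSelfAdjoint B) {e : H} (he : ‖e‖ ≤ 1) (m : ℕ) :
    ‖B e‖ ^ 2 ^ m ≤ ‖(B ^ 2 ^ m) e‖ := by
  induction m with
  | zero => simp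
  | succ m ih =>
    have hC : IsSelfAdjoint (B ^ 2 ^ m) := hB.pow _
    set C := B ^ 2 ^ m with hCdef
    have h2 : B ^ 2 ^ (m + 1) = C * C := by rw [hCdef, ← pow_add, pow_succ, mul_two]
    rw [h2, pow_succ, pow_mul]
    calc (‖B e‖ ^ 2 ^ m) ^ 2 ≤ ‖C e‖ ^ 2 := by gcongr
      _ = RCLike.re (inner ℂ (C e) (C e)) := by rw [inner_self_eq_norm_sq]
      _ = RCLike.re (inner ℂ ((C * C) e) e) := by
        rw [mul_apply_eq_comp, ← ContinuousLinearMap.adjoint_inner_left, hC.adjoint_eq]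
      _ ≤ ‖(C * C) e‖ * ‖e‖ := re_inner_le_norm _ _
      _ ≤ ‖(C * C) e‖ := mul_le_of_le_one_right (norm_nonneg _) he

/-- Every eigenvalue satisfies `s ≤ ‖T‖`, so `s^q ≤ ‖T‖^(q-p) s^p`. -/
theorem tsum_pow_sqrt_eigenvalues_ne_top {p q : ℝ} (hpq : p ≤ q) {T : H →L[ℂ] K}
    (hT : IsSchatten p T) :
    ∑' s : {s : ℝ // 0 < s}, (Module.finrank ℂ (eigenspace
        ((CFC.sqrt (ContinuousLinearMap.adjoint T ∘L T) : H →L[ℂ] H) : H →ₗ[ℂ] H)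
        ((s : ℝ) : ℂ)) : ℝ≥0∞) * ENNReal.ofReal ((s : ℝ) ^ q) ≠ ⊤ := by
  have h1 := (hT.2.mul_left (‖T‖ ^ (q - p))).tsum_ofReal_ne_top
  refine ne_top_of_le_ne_top h1 (ENNReal.tsum_le_tsum fun s => ?_)
  set E := eigenspace
        ((CFC.sqrt (ContinuousLinearMap.adjoint T ∘L T) : H →L[ℂ] H) : H →ₗ[ℂ] H)
        ((s : ℝ) : ℂ) with hE
  rcases Nat.eq_zero_or_pos (Module.finrank ℂ E) with h0 | h0
  · simp [h0]
  · have hE' := Module.finite_of_finrank_pos h0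
    have hs : (s : ℝ) ≤ ‖T‖ := by
      obtain ⟨v, hv⟩ := Module.finrank_pos_iff_exists_ne_zero.1 h0 |>.imp fun _ h => h
      have h2 := norm_apply_of_mem_eigenspace_sqrt T s.2 v.2
      have hv' : 0 < ‖(v : H)‖ := by simpa using hv
      have h3 := T.le_opNorm (v : H)
      rw [← mul_pow] at h2
      rw [pow_left_inj₀ (norm_nonneg _) (by have := s.2; positivity) two_ne_zero] at h2
      rw [h2] at h3
      exact le_of_mul_le_mul_right h3 hv'
    rw [← ENNReal.ofReal_natCast, ← ENNReal.ofReal_mul (by positivity)]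
    refine ENNReal.ofReal_le_ofReal ?_
    rw [mul_left_comm]
    gcongr
    rw [← sub_add_cancel q p, Real.rpow_add s.2, sub_add_cancel]
    have := s.2
    gcongr

/-- The values of an operator of class `S_p` on a Hilbert basis are summable to some power. -/
theorem IsSchatten.exists_tsum_enorm_pow_ne_top {p : ℝ} {T : H →L[ℂ] K} (hT : IsSchatten p T)
    {ι : Type*} {e : ι → H} (he : Orthonormal ℂ e) :
    ∃ k : ℕ, 2 ≤ k ∧ ∑' n, (‖T (e n)‖ₑ ^ 2) ^ k ≠ ⊤ := by
  -- The eigenvalues of `B = T* T` are `s²`, so the squared Hilbert–Schmidt norm of `B^(2^m)` is `∑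
  -- s^(4·2^m)`, finite once `p ≤ 4·2^m`.
  obtain ⟨m, hm⟩ : ∃ m : ℕ, p ≤ (4 * 2 ^ m : ℕ) := by
    obtain ⟨n, hn⟩ := exists_nat_ge p
    refine ⟨n, hn.trans ?_⟩
    have := n.lt_two_pow_self
    exact_mod_cast (by omega)
  refine ⟨2 ^ (m + 1), by rw [pow_succ]; have := Nat.one_le_two_pow (n := m); omega, ?_⟩
  set B := ContinuousLinearMap.adjoint T ∘L T with hBdef
  have hBc : IsCompactOperator B := isCompactOperator_adjoint_comp_self hT.1
  have hBp : B.IsPositive := ContinuousLinearMap.isPositive_adjoint_comp_self T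
  have hBsymm : (B : H →ₗ[ℂ] H).IsSymmetric := hBp.isSymmetric
  have hclosed : ∀ μ : ℂ, CompleteSpace (eigenspace (B : H →ₗ[ℂ] H) μ) := by
    intro μ
    have : IsClosed (eigenspace (B : H →ₗ[ℂ] H) μ : Set H) := by
      have h : (eigenspace (B : H →ₗ[ℂ] H) μ : Set H) = {x | B x = μ • x} := by
        ext x; simp
      rw [h]
      exact isClosed_eq B.continuous (continuous_const_smul μ)
    exact this.completeSpace_coe
  -- Bases of all eigenspaces of `B`, the kernel included, together form a Hilbert basis, by the
  -- spectral theorem for compact self-adjoint operators.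
  choose w b hb using fun μ : ℂ => exists_hilbertBasis ℂ (eigenspace (B : H →ₗ[ℂ] H) μ)
  have hon := hBsymm.orthogonalFamily_eigenspaces.orthonormal_sigma_orthonormal
    (v_family := fun μ => b μ) (fun μ => (b μ).orthonormal)
  set v : (Σ μ : ℂ, w μ) → H := fun a => (b a.1 a.2 : H)
  have hv : Orthonormal ℂ v := hon
  have hspan : (Submodule.span ℂ (Set.range v))ᗮ = ⊥ := by
    rw [eq_bot_iff, ← ContinuousLinearMap.orthogonalComplement_iSup_eigenspaces_eq_bot hBc hBsymm]
    intro x hx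
    rw [← Submodule.iInf_orthogonal, Submodule.mem_iInf]
    intro μ u hu
    have h1 : (⟨u, hu⟩ : eigenspace (B : H →ₗ[ℂ] H) μ) ∈
        (Submodule.span ℂ (Set.range (b μ))).topologicalClosure := by
      rw [(b μ).dense_span]; trivial
    have h2 : (⟨u, hu⟩ : eigenspace (B : H →ₗ[ℂ] H) μ) ∈
        closure (Submodule.span ℂ (Set.range (b μ)) : Set (eigenspace (B : H →ₗ[ℂ] H) μ)) := h1
    have h3 : IsClosed {y : eigenspace (B : H →ₗ[ℂ] H) μ | inner ℂ (y : H) x = 0} :=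
      isClosed_eq (by fun_prop) continuous_const
    refine closure_minimal (fun y hy => ?_) h3 h2
    refine Submodule.span_induction (s := Set.range (b μ))
      (p := fun y _ => inner ℂ (y : H) x = 0) ?_ ?_ ?_ ?_ hy
    · rintro _ ⟨i, rfl⟩
      exact hx _ (Submodule.subset_span ⟨⟨μ, i⟩, rfl⟩)
    · simp
    · intro y z _ _ hy hz
      simp [hy, hz]
    · intro c y _ hy
      simp [hy]
  let V : HilbertBasis (Σ μ : ℂ, w μ) ℂ H := HilbertBasis.mkOfOrthogonalEqBot hv hspan
  have hV : ∀ a, V a = v a := fun a => by simp [V]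
  have hBv : ∀ a, B (v a) = a.1 • v a := fun a => mem_eigenspace_iff.1 (b a.1 a.2).2
  set R := B ^ 2 ^ m
  have hRv : ∀ a, ‖R (v a)‖ₑ ^ 2 = ‖a.1‖ₑ ^ (2 * 2 ^ m) := by
    intro a
    have : ∀ j : ℕ, (B ^ j) (v a) = a.1 ^ j • v a := by
      intro j
      induction j with
      | zero => simp
      | succ j ih =>
        rw [pow_succ', mul_apply_eq_comp, ih, map_smul, hBv, smul_smul, pow_succ]
    have h1 : ‖v a‖ₑ = 1 := by rw [← ofReal_norm, hv.1 a]; simp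
    rw [this, enorm_smul, h1, mul_one, enorm_pow, ← pow_mul, mul_comm]
  have hstep : ∀ n, (‖T (e n)‖ₑ ^ 2) ^ 2 ^ (m + 1) ≤ ‖R (e n)‖ₑ ^ 2 := by
    intro n
    rw [enorm_sq_eq_ofReal, enorm_sq_eq_ofReal, ← ENNReal.ofReal_pow (by positivity)]
    refine ENNReal.ofReal_le_ofReal ?_
    have h1 : ‖T (e n)‖ ^ 2 ≤ ‖B (e n)‖ := by
      calc ‖T (e n)‖ ^ 2 = RCLike.re (inner ℂ (B (e n)) (e n)) := by
            rw [← inner_self_eq_norm_sq (𝕜 := ℂ)]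
            exact congrArg _ (ContinuousLinearMap.adjoint_inner_left T (e n) (T (e n))).symm
        _ ≤ ‖B (e n)‖ * ‖e n‖ := re_inner_le_norm _ _
        _ = ‖B (e n)‖ := by rw [he.1 n, mul_one]
    calc (‖T (e n)‖ ^ 2) ^ 2 ^ (m + 1) ≤ ‖B (e n)‖ ^ 2 ^ (m + 1) := by gcongr
      _ = (‖B (e n)‖ ^ 2 ^ m) ^ 2 := by rw [pow_succ, pow_mul]
      _ ≤ _ := by gcongr; exact norm_pow_two_pow_le hBp.isSelfAdjoint (he.1 n).le m
  refine ne_top_of_le_ne_top ?_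
    ((ENNReal.tsum_le_tsum hstep).trans (tsum_enorm_sq_le he V R))
  simp_rw [hV, hRv]
  rw [ENNReal.tsum_sigma']
  have hinj : Function.Injective fun s : {s : ℝ // 0 < s} => (((s : ℝ) ^ 2 : ℝ) : ℂ) := by
    intro s t h
    have h1 : (s : ℝ) ^ 2 = (t : ℝ) ^ 2 := Complex.ofReal_injective h
    exact Subtype.ext ((pow_left_inj₀ s.2.le t.2.le two_ne_zero).1 h1)
  -- Reindex by `μ = s²`. This loses nothing: a nonzero term needs a nonzero eigenvalue, and
  -- positivity of `B` makes that eigenvalue positive.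
  rw [← hinj.tsum_eq]
  · refine ne_of_eq_of_ne (tsum_congr fun s => ?_) (tsum_pow_sqrt_eigenvalues_ne_top hm hT)
    rw [eigenspace_sqrt T s.2]
    set μ : ℂ := (((s : ℝ) ^ 2 : ℝ) : ℂ)
    have hμ : μ ≠ 0 := Complex.ofReal_ne_zero.2 (pow_pos s.2 2).ne'
    have := ContinuousLinearMap.finite_dimensional_eigenspace hBc μ hμ
    have hfin : Finite (w μ) := (b μ).orthonormal.linearIndependent.finite
    have := Fintype.ofFinite (w μ)
    rw [Module.finrank_eq_card_basis (b μ).toOrthonormalBasis.toBasis, tsum_fintype]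
    simp only [Finset.sum_const, Finset.card_univ, nsmul_eq_mul]
    congr 1
    rw [Real.rpow_natCast, ENNReal.ofReal_pow s.2.le, ← ofReal_norm, Complex.norm_real,
      Real.norm_of_nonneg (by positivity), ENNReal.ofReal_pow s.2.le, ← pow_mul]
    congr 1
    ring
  · intro μ hμ
    obtain ⟨a, ha⟩ : ∃ a : w μ, True := by
      by_contra hcon
      push Not at hcon
      apply hμ
      exact ENNReal.tsum_eq_zero.2 fun a => (hcon a).elim
    have hμ0 : μ ≠ 0 := by
      rintro rfl
      exact hμ (by simp)
    have hva := hBv ⟨μ, a⟩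
    have hpos := hBp.inner_nonneg_left (v ⟨μ, a⟩)
    rw [hva, inner_smul_left, inner_self_eq_norm_sq_to_K, hv.1] at hpos
    simp only [Complex.coe_algebraMap, Complex.ofReal_one, one_pow, mul_one] at hpos
    obtain ⟨hre, him⟩ := Complex.nonneg_iff.1 hpos
    simp only [Complex.conj_re, Complex.conj_im] at hre him
    have hμre : μ = (μ.re : ℂ) := Complex.ext (by simp) (by simp; linarith)
    have hre' : 0 < μ.re := lt_of_le_of_ne hre fun h => hμ0 (by rw [hμre, ← h]; simp)
    refine ⟨⟨√μ.re, Real.sqrt_pos.2 hre'⟩, ?_⟩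
    simp only [Real.sq_sqrt hre]
    exact hμre.symm

end Operators

end HardyWeighted

end

/-! ### Function theory in `H²`: backward shift, Herglotz majorants, Parseval on circles. -/

noncomputable section

namespace HardyWeighted

open Filter Topology Metric

/-- The M-test on smaller discs; the majorant may depend on `r` because it may blow up at the unit
circle. -/
theorem differentiableOn_ball_tsum {F : ℕ → ℂ → ℂ} (u : ℝ → ℕ → ℝ)
    (hu : ∀ r, 0 < r → r < 1 → Summable (u r)) (hF : ∀ n, DifferentiableOn ℂ (F n) (ball 0 1))
    (hle : ∀ r, 0 < r → r < 1 → ∀ n, ∀ z ∈ ball (0 : ℂ) r, ‖F n z‖ ≤ u r n) :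
    DifferentiableOn ℂ (fun z => ∑' n, F n z) (ball 0 1) := by
  intro z hz
  obtain ⟨r, hr, hr1⟩ := exists_between (mem_ball_zero_iff.1 hz)
  have hr0 := (norm_nonneg z).trans_lt hr
  have h := Complex.differentiableOn_tsum_of_summable_norm (hu r hr0 hr1)
    (fun n => (hF n).mono (ball_subset_ball hr1.le)) isOpen_ball (hle r hr0 hr1)
  exact (h.differentiableAt (isOpen_ball.mem_nhds (mem_ball_zero_iff.2 hr))).differentiableWithinAt

theorem SqSummable.hasSum_sq (c : SqSummable) : HasSum (fun n => ‖c n‖ ^ 2) (‖c‖ ^ 2) := by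
  simpa using lp.hasSum_norm (p := 2) (by norm_num) c

theorem SqSummable.norm_apply_le (c : SqSummable) (n : ℕ) : ‖c n‖ ≤ ‖c‖ :=
  lp.norm_apply_le_norm (by norm_num) c n

theorem SqSummable.norm_term_le (c : SqSummable) {z : ℂ} {r : ℝ} (hz : ‖z‖ ≤ r) (n : ℕ) :
    ‖c n * z ^ n‖ ≤ ‖c‖ * r ^ n := by
  rw [norm_mul, norm_pow]
  gcongr
  exact c.norm_apply_le n

theorem SqSummable.summable (c : SqSummable) {z : ℂ} (hz : z ∈ ball (0 : ℂ) 1) :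
    Summable fun n => c n * z ^ n :=
  Summable.of_norm_bounded
    ((summable_geometric_of_lt_one (norm_nonneg z) (mem_ball_zero_iff.1 hz)).mul_left ‖c‖)
    fun n => c.norm_term_le le_rfl n

theorem SqSummable.norm_tsum_le (c : SqSummable) {z : ℂ} (hz : z ∈ ball (0 : ℂ) 1) :
    ‖∑' n, c n * z ^ n‖ ≤ ‖c‖ * (1 - ‖z‖)⁻¹ :=
  tsum_of_norm_bounded
    ((hasSum_geometric_of_lt_one (norm_nonneg z) (mem_ball_zero_iff.1 hz)).mul_left ‖c‖)
    fun n => c.norm_term_le le_rfl n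

theorem SqSummable.differentiableOn (c : SqSummable) :
    DifferentiableOn ℂ (fun z => ∑' n, c n * z ^ n) (ball 0 1) := by
  refine differentiableOn_ball_tsum (fun r n => ‖c‖ * r ^ n)
    (fun r hr hr1 => (summable_geometric_of_lt_one hr.le hr1).mul_left _)
    (fun n => by fun_prop) fun r _ _ n z hz => ?_
  exact c.norm_term_le (mem_ball_zero_iff.1 hz).le n

theorem H2.apply_eq_tsum (f : H2) (z : 𝔻) : f z = ∑' n, H2.coeffs f n * (z : ℂ) ^ n := by
  have h : f = (LinearEquiv.ofInjective powerSeries powerSeries_injective) (H2.coeffs f) :=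
    (LinearEquiv.apply_symm_apply _ f).symm
  conv_lhs => rw [h]
  rfl

theorem H2.coeffs_symm_apply (c : SqSummable) (z : 𝔻) :
    H2.coeffs.symm c z = ∑' n, c n * (z : ℂ) ^ n := rfl

theorem H2.norm_coeffs (f : H2) : ‖H2.coeffs f‖ = ‖f‖ := rfl

theorem H2.ext {f g : H2} (h : ∀ z, f z = g z) : f = g := Subtype.ext (funext h)

/-- The monomials `zⁿ` as a Hilbert basis of `H²`. -/
def monomialBasis : HilbertBasis ℕ ℂ H2 :=
  HilbertBasis.ofRepr { H2.coeffs with norm_map' := fun _ => rfl }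

theorem monomialBasis_apply (n : ℕ) (z : 𝔻) : monomialBasis n z = (z : ℂ) ^ n := by
  classical
  have h : monomialBasis n = H2.coeffs.symm (lp.single 2 n (1 : ℂ)) :=
    (monomialBasis.repr_symm_single n).symm
  rw [h, H2.coeffs_symm_apply, tsum_eq_single n]
  · simp
  · intro m hm
    simp [lp.single_apply, hm]

/-- The backward shift on square summable sequences. -/
def backwardShift : SqSummable →L[ℂ] SqSummable :=
  LinearMap.mkContinuous
    { toFun := fun c => ⟨fun n => c (n + 1), by
        refine memℓp_gen ?_
        simpa using (summable_nat_add_iff 1).2 c.hasSum_sq.summable⟩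
      map_add' := fun _ _ => rfl
      map_smul' := fun _ _ => rfl } 1 fun c => by
    rw [one_mul]
    refine (pow_le_pow_iff_left₀ (norm_nonneg _) (norm_nonneg _) two_ne_zero).1 ?_
    rw [← (SqSummable.hasSum_sq _).tsum_eq, ← c.hasSum_sq.tsum_eq,
      c.hasSum_sq.summable.tsum_eq_zero_add]
    exact le_add_of_nonneg_left (sq_nonneg _)

theorem backwardShift_apply (c : SqSummable) (n : ℕ) : backwardShift c n = c (n + 1) := rfl

theorem norm_backwardShift_sq (c : SqSummable) :
    ‖backwardShift c‖ ^ 2 = ‖c‖ ^ 2 - ‖c 0‖ ^ 2 := by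
  rw [← (SqSummable.hasSum_sq _).tsum_eq, ← c.hasSum_sq.tsum_eq,
    c.hasSum_sq.summable.tsum_eq_zero_add]
  simp [backwardShift_apply]

theorem norm_backwardShift_apply_le (c : SqSummable) : ‖backwardShift c‖ ≤ ‖c‖ := by
  refine (pow_le_pow_iff_left₀ (norm_nonneg _) (norm_nonneg _) two_ne_zero).1 ?_
  rw [norm_backwardShift_sq]
  exact sub_le_self _ (sq_nonneg _)

theorem isUnit_one_sub_smul_backwardShift {z : ℂ} (hz : z ∈ ball (0 : ℂ) 1) :
    IsUnit (1 - z • backwardShift) := by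
  refine isUnit_one_sub_of_norm_lt_one ?_
  have h1 : ‖backwardShift‖ ≤ 1 := LinearMap.mkContinuous_norm_le _ zero_le_one _
  rw [norm_smul]
  exact (mul_le_of_le_one_right (norm_nonneg z) h1).trans_lt (mem_ball_zero_iff.1 hz)

/-- Since `f n = h n - z h (n+1)`, the partial sums telescope. Point evaluation at `z` is thus the
zeroth coefficient of a resolvent vector. -/
theorem eq_tsum_of_sub_smul_backwardShift {f h : SqSummable} {z : ℂ} (hz : z ∈ ball (0 : ℂ) 1)
    (hf : h - z • backwardShift h = f) : h 0 = ∑' n, f n * z ^ n := by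
  have hpart : ∀ N, ∑ n ∈ Finset.range N, f n * z ^ n = h 0 - h N * z ^ N := by
    intro N
    induction N with
    | zero => simp
    | succ N ih =>
      rw [Finset.sum_range_succ, ih, ← hf]
      simp only [lp.coeFn_sub, lp.coeFn_smul, Pi.sub_apply, Pi.smul_apply, backwardShift_apply,
        smul_eq_mul]
      ring
  have h1 : Tendsto (fun N => h N * z ^ N) atTop (𝓝 0) := (h.summable hz).tendsto_atTop_zero
  have h2 : Tendsto (fun N => h 0 - h N * z ^ N) atTop (𝓝 (h 0)) := by
    simpa using tendsto_const_nhds.sub h1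
  have h3 := (f.summable hz).hasSum.tendsto_sum_nat
  simp_rw [hpart] at h3
  exact tendsto_nhds_unique h2 h3

/-- The squared modulus of a function in `H²` is dominated by the real part of an analytic function
of controlled growth (the Herglotz transform of its boundary values). -/
theorem exists_analytic_majorant (f : SqSummable) : ∃ G : ℂ → ℂ,
    DifferentiableOn ℂ G (ball 0 1) ∧ ∀ z ∈ ball (0 : ℂ) 1,
      ‖G z‖ ≤ 2 * ‖f‖ ^ 2 * (1 - ‖z‖)⁻¹ ∧ ‖∑' n, f n * z ^ n‖ ^ 2 ≤ (G z).re := by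
  -- On the disc this is a true inverse, since the backward shift is a contraction. `G` is analytic
  -- because the inner product is linear in its second argument, the only place where `z` enters.
  let Q : ℂ → SqSummable →L[ℂ] SqSummable := fun z => Ring.inverse (1 - z • backwardShift)
  let G : ℂ → ℂ := fun z => innerSL ℂ f (((1 + z • backwardShift) * Q z) f)
  refine ⟨G, ?_, fun z hz => ?_⟩
  · have hQ : DifferentiableOn ℂ Q (ball 0 1) := fun z hz =>
      ((by fun_prop : DifferentiableAt ℂ (fun z : ℂ => 1 - z • backwardShift) z).inverse
        (isUnit_one_sub_smul_backwardShift hz)).differentiableWithinAt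
    have hM : DifferentiableOn ℂ (fun z => (1 + z • backwardShift) * Q z) (ball 0 1) :=
      (by fun_prop : DifferentiableOn ℂ (fun z : ℂ => 1 + z • backwardShift) (ball 0 1)).mul hQ
    exact (innerSL ℂ f).differentiable.comp_differentiableOn
      (hM.clm_apply (differentiableOn_const f))
  · have hz1 := mem_ball_zero_iff.1 hz
    set h := Q z f
    have hf : h - z • backwardShift h = f := by
      have : ((1 - z • backwardShift) * Q z) f = f := by
        rw [Ring.mul_inverse_cancel _ (isUnit_one_sub_smul_backwardShift hz)]
        rfl
      simpa using this
    have hG : G z = inner ℂ (h - z • backwardShift h) (h + z • backwardShift h) := by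
      rw [hf]; rfl
    have hA := norm_backwardShift_apply_le h
    have hh0 : ‖h 0‖ ≤ ‖h‖ := h.norm_apply_le 0
    have hhle : ‖h‖ ≤ ‖f‖ * (1 - ‖z‖)⁻¹ := by
      rw [← div_eq_mul_inv, le_div_iff₀ (by linarith)]
      have h1 : ‖h‖ ≤ ‖f‖ + ‖z‖ * ‖h‖ := by
        calc ‖h‖ = ‖f + z • backwardShift h‖ := by rw [← hf]; simp
          _ ≤ ‖f‖ + ‖z‖ * ‖backwardShift h‖ := by
            rw [← norm_smul]; exact norm_add_le _ _
          _ ≤ _ := by gcongr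
      linarith
    constructor
    · rw [hG, hf]
      have h2 : ‖h + z • backwardShift h‖ ≤ 2 * ‖h‖ := by
        refine (norm_add_le _ _).trans ?_
        rw [norm_smul]
        nlinarith [norm_nonneg h, norm_nonneg z, norm_nonneg (backwardShift h)]
      calc _ ≤ ‖f‖ * ‖h + z • backwardShift h‖ := norm_inner_le_norm _ _
        _ ≤ ‖f‖ * (2 * (‖f‖ * (1 - ‖z‖)⁻¹)) := by gcongr; linarith
        _ = _ := by ring
    · rw [← eq_tsum_of_sub_smul_backwardShift hz hf, hG]
      have h3 : (inner ℂ (h - z • backwardShift h) (h + z • backwardShift h)).re =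
          ‖h‖ ^ 2 - ‖z • backwardShift h‖ ^ 2 := by
        rw [inner_sub_left, inner_add_right, inner_add_right, inner_self_eq_norm_sq_to_K,
          inner_self_eq_norm_sq_to_K, ← inner_conj_symm (z • backwardShift h) h]
        have h6 := Complex.conj_re (inner ℂ h (z • backwardShift h))
        simp only [Complex.sub_re, Complex.add_re, h6, ← Complex.ofReal_pow, Complex.coe_algebraMap,
          Complex.ofReal_re]
        ring
      -- The real part is `(1 - |z|²) ‖h‖² + |z|² |h 0|²`, which is at least `|h 0|²`.
      rw [h3, norm_smul, mul_pow, norm_backwardShift_sq]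
      have h4 : ‖h 0‖ ^ 2 ≤ ‖h‖ ^ 2 := by gcongr
      have h5 : ‖z‖ ^ 2 ≤ 1 := by nlinarith [norm_nonneg z]
      nlinarith

/-- Parseval's inequality for a finite family of power series on the disc. -/
theorem sum_norm_sq_coeff_le {ι : Type*} (s : Finset ι) (g : ι → ℂ → ℂ) (c : ι → ℕ → ℂ)
    (hc : ∀ i ∈ s, ∀ z ∈ ball (0 : ℂ) 1, HasSum (fun n => c i n * z ^ n) (g i z)) {C : ℝ}
    (hC : ∀ z ∈ ball (0 : ℂ) 1, ∑ i ∈ s, ‖g i z‖ ^ 2 ≤ C) (K : ℕ) :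
    ∑ i ∈ s, ∑ k ∈ Finset.range K, ‖c i k‖ ^ 2 ≤ C := by
  have hC0 : 0 ≤ C := le_trans (Finset.sum_nonneg fun _ _ => sq_nonneg _) (hC 0 (by simp))
  have key : ∀ r : ℝ, 0 < r → r < 1 →
      ∑ i ∈ s, ∑ k ∈ Finset.range K, ‖c i k * (r : ℂ) ^ k‖ ^ 2 ≤ C := by
    intro r hr hr1
    have hrb : ∀ ζ : ℂ, ‖ζ‖ = 1 → (r : ℂ) * ζ ∈ ball (0 : ℂ) 1 := fun ζ hζ => by
      rw [mem_ball_zero_iff, norm_mul, hζ, mul_one, Complex.norm_real, Real.norm_of_nonneg hr.le]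
      exact hr1
    have hsum : ∀ i ∈ s, Summable fun k => ‖c i k * (r : ℂ) ^ k‖ := fun i hi => by
      have := (hc i hi (r * 1) (hrb 1 (by simp))).summable.norm
      simpa using this
    -- Taylor polynomials of `ζ ↦ g i (r ζ)`. Parseval holds exactly for them, and on the unit
    -- circle they differ from the function by at most the tail `t i N`.
    let P : ι → ℕ → Polynomial ℂ := fun i N =>
      ∑ k ∈ Finset.range N, Polynomial.monomial k (c i k * (r : ℂ) ^ k)
    have hcoeff : ∀ i N k, (P i N).coeff k = if k < N then c i k * (r : ℂ) ^ k else 0 := by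
      intro i N k
      simp [P, Polynomial.coeff_monomial]
    have hPle : ∀ i N, K ≤ N → ∑ k ∈ Finset.range K, ‖c i k * (r : ℂ) ^ k‖ ^ 2 ≤
        Real.circleAverage (fun ζ => ‖(P i N).eval ζ‖ ^ 2) 0 1 := by
      intro i N hN
      rw [← Polynomial.sum_sq_norm_coeff_eq_circleAverage]
      calc ∑ k ∈ Finset.range K, ‖c i k * (r : ℂ) ^ k‖ ^ 2
          = ∑ k ∈ Finset.range K, ‖(P i N).coeff k‖ ^ 2 := by
            refine Finset.sum_congr rfl fun k hk => ?_
            rw [hcoeff, if_pos ((Finset.mem_range.1 hk).trans_le hN)]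
        _ ≤ ∑ k ∈ Finset.range K ∪ (P i N).support, ‖(P i N).coeff k‖ ^ 2 :=
            Finset.sum_le_sum_of_subset_of_nonneg Finset.subset_union_left
              fun _ _ _ => sq_nonneg _
        _ = _ := by
            refine (Finset.sum_subset Finset.subset_union_right fun k _ hk => ?_).symm
            simp [Polynomial.notMem_support_iff.1 hk]
    let t : ι → ℕ → ℝ := fun i N => ∑' k, ‖c i (k + N) * (r : ℂ) ^ (k + N)‖
    have ht0 : ∀ i N, 0 ≤ t i N := fun i N => tsum_nonneg fun _ => norm_nonneg _
    have htail : ∀ i ∈ s, ∀ N, ∀ ζ : ℂ, ‖ζ‖ = 1 →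
        ‖(P i N).eval ζ‖ ≤ ‖g i (r * ζ)‖ + t i N := by
      intro i hi N ζ hζ
      have h1 := hc i hi _ (hrb ζ hζ)
      have h2 := h1.summable.sum_add_tsum_nat_add N
      rw [h1.tsum_eq] at h2
      have h3 : (P i N).eval ζ = ∑ k ∈ Finset.range N, c i k * ((r : ℂ) * ζ) ^ k := by
        simp [P, Polynomial.eval_finsetSum, mul_pow, mul_assoc]
      have hn : ∀ k, ‖c i k * ((r : ℂ) * ζ) ^ k‖ = ‖c i k * (r : ℂ) ^ k‖ := fun k => by
        simp [mul_pow, hζ]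
      have h4 : ‖∑' k, c i (k + N) * ((r : ℂ) * ζ) ^ (k + N)‖ ≤ t i N := by
        refine (norm_tsum_le_tsum_norm ?_).trans (le_of_eq ?_)
        · simp_rw [hn]
          exact (summable_nat_add_iff (f := fun k => ‖c i k * (r : ℂ) ^ k‖) N).2 (hsum i hi)
        · simp_rw [hn]
          rfl
      rw [h3, ← h2]
      calc _ = ‖(∑ k ∈ Finset.range N, c i k * ((r : ℂ) * ζ) ^ k +
                ∑' k, c i (k + N) * ((r : ℂ) * ζ) ^ (k + N)) -
                ∑' k, c i (k + N) * ((r : ℂ) * ζ) ^ (k + N)‖ := by rw [add_sub_cancel_right]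
        _ ≤ _ := (norm_sub_le _ _).trans (by gcongr)
    have hgle : ∀ i ∈ s, ∀ z ∈ ball (0 : ℂ) 1, ‖g i z‖ ≤ √C := fun i hi z hz =>
      Real.le_sqrt_of_sq_le ((Finset.single_le_sum (f := fun i => ‖g i z‖ ^ 2)
        (fun _ _ => sq_nonneg _) hi).trans (hC z hz))
    have hbound : ∀ N, K ≤ N → ∑ i ∈ s, ∑ k ∈ Finset.range K, ‖c i k * (r : ℂ) ^ k‖ ^ 2 ≤
        C + ∑ i ∈ s, (2 * √C * t i N + t i N ^ 2) := by
      intro N hN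
      have hci : ∀ i ∈ s, CircleIntegrable (fun ζ => ‖(P i N).eval ζ‖ ^ 2) 0 1 := fun i _ =>
        (Continuous.continuousOn (by fun_prop)).circleIntegrable zero_le_one
      refine (Finset.sum_le_sum fun i _ => hPle i N hN).trans ?_
      rw [← Real.circleAverage_fun_sum hci]
      refine Real.circleAverage_mono_on_of_le_circle ?_ fun ζ hζ => ?_
      · exact (Continuous.continuousOn (by fun_prop)).circleIntegrable zero_le_one
      · have hζ1 : ‖ζ‖ = 1 := by simpa using hζ
        -- Termwise, `|P|² ≤ (|g| + t)² ≤ |g|² + 2√C t + t²`.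
        refine le_trans ?_ (add_le_add_left (hC _ (hrb ζ hζ1)) _)
        rw [← Finset.sum_add_distrib]
        refine Finset.sum_le_sum fun i hi => ?_
        have h1 := htail i hi N ζ hζ1
        have h2 := hgle i hi _ (hrb ζ hζ1)
        nlinarith [norm_nonneg ((P i N).eval ζ), ht0 i N, norm_nonneg (g i (r * ζ)),
          mul_le_mul_of_nonneg_right h2 (ht0 i N)]
    have hlim : Tendsto (fun N => C + ∑ i ∈ s, (2 * √C * t i N + t i N ^ 2)) atTop (𝓝 C) := by
      have ht : ∀ i, Tendsto (t i) atTop (𝓝 0) := fun i =>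
        tendsto_sum_nat_add fun k => ‖c i k * (r : ℂ) ^ k‖
      have : Tendsto (fun N => C + ∑ i ∈ s, (2 * √C * t i N + t i N ^ 2)) atTop
          (𝓝 (C + ∑ i ∈ s, (2 * √C * 0 + 0 ^ 2))) :=
        tendsto_const_nhds.add (tendsto_finsetSum _ fun i _ =>
          ((ht i).const_mul _).add ((ht i).pow 2))
      simpa using this
    exact ge_of_tendsto hlim (eventually_atTop.2 ⟨K, hbound⟩)
  have hlim : Tendsto (fun r : ℝ => ∑ i ∈ s, ∑ k ∈ Finset.range K, ‖c i k * (r : ℂ) ^ k‖ ^ 2)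
      (𝓝[<] 1) (𝓝 (∑ i ∈ s, ∑ k ∈ Finset.range K, ‖c i k * ((1 : ℝ) : ℂ) ^ k‖ ^ 2)) :=
    Continuous.tendsto' (by fun_prop) _ _ rfl |>.mono_left nhdsWithin_le_nhds
  simp only [Complex.ofReal_one, one_pow, mul_one] at hlim
  refine le_of_tendsto hlim ?_
  filter_upwards [Ioo_mem_nhdsLT (zero_lt_one' ℝ)] with r hr
  exact key r hr.1 hr.2

/-- A bounded analytic function on the disc belongs to `H²`. -/
theorem exists_H2_of_norm_le {G : ℂ → ℂ} (hG : DifferentiableOn ℂ G (ball 0 1)) {C : ℝ}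
    (hC : ∀ z ∈ ball (0 : ℂ) 1, ‖G z‖ ≤ C) : ∃ f : H2, (∀ z : 𝔻, f z = G z) ∧ ‖f‖ ≤ C := by
  have hC0 : 0 ≤ C := (norm_nonneg _).trans (hC 0 (by simp))
  let c : ℕ → ℂ := fun n => (n.factorial : ℂ)⁻¹ * iteratedDeriv n G 0
  have hc : ∀ z ∈ ball (0 : ℂ) 1, HasSum (fun n => c n * z ^ n) (G z) := fun z hz => by
    have h := Complex.hasSum_taylorSeries_on_ball hG hz
    simp only [sub_zero, smul_eq_mul] at h
    refine h.congr_fun fun n => ?_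
    simp only [c]
    ring
  have hK := sum_norm_sq_coeff_le {()} (fun _ => G) (fun _ => c) (fun _ _ => hc) (C := C ^ 2)
    (fun z hz => by simpa using pow_le_pow_left₀ (norm_nonneg _) (hC z hz) 2)
  simp only [Finset.sum_singleton] at hK
  have hs : ∀ s : Finset ℕ, ∑ i ∈ s, ‖c i‖ ^ 2 ≤ C ^ 2 := fun s => by
    obtain ⟨N, hN⟩ := s.exists_nat_subset_range
    exact (Finset.sum_le_sum_of_subset_of_nonneg hN fun _ _ _ => sq_nonneg _).trans (hK N)
  have hmem : Memℓp c 2 := memℓp_gen' (C := C ^ 2) (by simpa using hs)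
  refine ⟨H2.coeffs.symm ⟨c, hmem⟩, fun z => ?_, ?_⟩
  · rw [H2.coeffs_symm_apply]
    exact (hc z (mem_ball_zero_iff.2 z.norm_lt_one)).tsum_eq
  · rw [← H2.norm_coeffs, LinearEquiv.apply_symm_apply]
    exact lp.norm_le_of_forall_sum_le (by norm_num) hC0 (by simpa using hs)

/-- A finite family in `H²` whose square function is bounded by `√C` has squared norms of sum at
most `C`. -/
theorem sum_norm_sq_le {ι : Type*} (s : Finset ι) (f : ι → H2) {C : ℝ}
    (hC : ∀ z : 𝔻, ∑ i ∈ s, ‖f i z‖ ^ 2 ≤ C) : ∑ i ∈ s, ‖f i‖ ^ 2 ≤ C := by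
  have hK := sum_norm_sq_coeff_le s (fun i z => ∑' n, H2.coeffs (f i) n * z ^ n)
    (fun i n => H2.coeffs (f i) n) (fun i _ z hz => (SqSummable.summable _ hz).hasSum) (C := C)
    (fun z hz => by
      have := hC (Complex.UnitDisc.mk z (mem_ball_zero_iff.1 hz))
      simpa only [H2.apply_eq_tsum, Complex.UnitDisc.coe_mk] using this)
  have hlim : Tendsto (fun K => ∑ i ∈ s, ∑ k ∈ Finset.range K, ‖H2.coeffs (f i) k‖ ^ 2) atTop
      (𝓝 (∑ i ∈ s, ‖f i‖ ^ 2)) :=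
    tendsto_finsetSum _ fun i _ => (H2.coeffs (f i)).hasSum_sq.tendsto_sum_nat
  exact le_of_tendsto' hlim hK

end HardyWeighted

end

/-! ### From weighted square functions to a Hilbert–Schmidt weight. -/

noncomputable section

namespace HardyWeighted

open Filter Topology Metric

/-- This is Jensen's inequality for the convex function `t ↦ t^(-β)` and the geometric distribution
`(1 - x) xⁿ`, under which `n + 1` has mean `1/(1 - x)`. The proof sums the tangent line at `t = 1`.
-/
theorem rpow_sub_one_le_tsum {x β : ℝ} (hx : 0 ≤ x) (hx1 : x < 1) (hβ : 0 < β) (hβ1 : β < 1) :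
    (1 - x) ^ (β - 1) ≤ ∑' n : ℕ, ((n : ℝ) + 1) ^ (-β) * x ^ n := by
  have hy : 0 < 1 - x := by linarith
  have h1 : HasSum (fun n : ℕ => x ^ n) (1 - x)⁻¹ := hasSum_geometric_of_lt_one hx hx1
  have h2 : HasSum (fun n : ℕ => (n : ℝ) * x ^ n) (x / (1 - x) ^ 2) :=
    hasSum_coe_mul_geometric_of_norm_lt_one (by rwa [Real.norm_of_nonneg hx])
  have h3 := ((h1.mul_left (1 + β)).sub ((h2.add h1).mul_left (β * (1 - x)))).mul_left
    ((1 - x) ^ β)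
  have hval : (1 - x) ^ β * ((1 + β) * (1 - x)⁻¹ -
      β * (1 - x) * (x / (1 - x) ^ 2 + (1 - x)⁻¹)) = (1 - x) ^ (β - 1) := by
    rw [Real.rpow_sub_one hy.ne']
    field_simp
    ring
  rw [← hval, ← h3.tsum_eq]
  refine h3.summable.tsum_le_tsum (fun n => ?_) ?_
  · have hn : (0 : ℝ) < (n : ℝ) + 1 := by positivity
    set t := ((n : ℝ) + 1) * (1 - x) with ht
    have ht0 : 0 < t := by positivity
    have hD : t ^ β ≤ 1 + β * (t - 1) := by
      have := rpow_one_add_le_one_add_mul_self (s := t - 1) (by linarith) hβ.le hβ1.le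
      rwa [add_sub_cancel] at this
    have hinv : 2 - t ^ β ≤ t ^ (-β) := by
      have hp := Real.rpow_pos_of_pos ht0 β
      rw [Real.rpow_neg ht0.le, ← one_div, le_div_iff₀ hp]
      nlinarith [sq_nonneg (t ^ β - 1)]
    have hsplit : ((n : ℝ) + 1) ^ (-β) = (1 - x) ^ β * t ^ (-β) := by
      rw [ht, Real.mul_rpow hn.le hy.le, mul_left_comm, ← Real.rpow_add hy]
      simp
    have hlin : (1 + β) * x ^ n - β * (1 - x) * ((n : ℝ) * x ^ n + x ^ n) =
        (1 + β - β * t) * x ^ n := by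
      rw [ht]; ring
    rw [hlin, hsplit, mul_assoc]
    gcongr
    linarith
  · refine h1.summable.of_nonneg_of_le (fun n => by positivity) fun n => ?_
    refine mul_le_of_le_one_left (by positivity) ?_
    exact Real.rpow_le_one_of_one_le_of_nonpos (by simp) (by linarith)

/-- Hölder with exponents `k` and `k/(k-1)`. The weight exponent `β = 1 - 1/(2k)` lies strictly
between `1 - 1/k`, above which the dual series converges, and `1`, below which `1 - β` is a gain. -/
theorem summable_weight_mul {k : ℕ} (hk : 2 ≤ k) {a : ℕ → ℝ} (ha : ∀ n, 0 ≤ a n)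
    (hs : Summable fun n => a n ^ k) :
    Summable fun n : ℕ => ((n : ℝ) + 1) ^ (-(1 - 1 / (2 * k : ℝ))) * a n := by
  have hk' : (2 : ℝ) ≤ k := by exact_mod_cast hk
  have hpq : (k : ℝ).HolderConjugate ((k : ℝ).conjExponent) :=
    Real.HolderConjugate.conjExponent (by linarith)
  refine Real.summable_mul_of_Lp_Lq_of_nonneg hpq.symm (fun n => by positivity) ha ?_
    (by simpa using hs)
  have hmul : ∀ n : ℕ, (((n : ℝ) + 1) ^ (-(1 - 1 / (2 * k : ℝ)))) ^ (k : ℝ).conjExponent =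
      ((n : ℝ) + 1) ^ (-(1 - 1 / (2 * k : ℝ)) * (k : ℝ).conjExponent) := fun n =>
    (Real.rpow_mul (by positivity) _ _).symm
  simp_rw [hmul]
  have h := (summable_nat_add_iff 1).2 (Real.summable_nat_rpow (p := -(1 - 1 / (2 * k : ℝ)) *
    (k : ℝ).conjExponent) |>.2 ?_)
  · simpa using h
  · have h1 : (0 : ℝ) < k - 1 := by linarith
    rw [Real.conjExponent, neg_mul, neg_lt_neg_iff]
    rw [show (1 - 1 / (2 * k : ℝ)) * (k / (k - 1)) = (2 * k - 1) / (2 * (k - 1)) by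
      field_simp]
    rw [lt_div_iff₀ (by linarith)]
    linarith

/-- A weighted square function of a family in `H²` whose weighted squared norms are summable is
dominated by the real part of an analytic function. -/
theorem exists_analytic_majorant_tsum (f : ℕ → H2) {c : ℕ → ℝ} (hc : ∀ n, 0 ≤ c n)
    (hs : Summable fun n => c n * ‖f n‖ ^ 2) : ∃ F : ℂ → ℂ, DifferentiableOn ℂ F (ball 0 1) ∧
      ∀ z : 𝔻, 1 + ∑' n, c n * ‖f n z‖ ^ 2 ≤ (F z).re := by
  choose G hGd hG using fun n => exists_analytic_majorant (H2.coeffs (f n))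
  have hle : ∀ n, ∀ z ∈ ball (0 : ℂ) 1,
      ‖(c n : ℂ) * G n z‖ ≤ 2 * (1 - ‖z‖)⁻¹ * (c n * ‖f n‖ ^ 2) := fun n z hz => by
    rw [norm_mul, Complex.norm_real, Real.norm_of_nonneg (hc n)]
    refine (mul_le_mul_of_nonneg_left (hG n z hz).1 (hc n)).trans_eq ?_
    rw [H2.norm_coeffs]
    ring
  -- The summand `1` keeps the real part at least `1`, so that one can divide by `F`.
  refine ⟨fun z => 1 + ∑' n, (c n : ℂ) * G n z, ?_, fun z => ?_⟩
  · refine (differentiableOn_const 1).add (differentiableOn_ball_tsum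
      (fun r n => 2 * (1 - r)⁻¹ * (c n * ‖f n‖ ^ 2)) (fun r _ _ => hs.mul_left _)
      (fun n => (hGd n).const_mul _) fun r hr hr1 n z hz => ?_)
    have hzr := mem_ball_zero_iff.1 hz
    refine (hle n z (mem_ball_zero_iff.2 (hzr.trans hr1))).trans ?_
    have := mul_nonneg (hc n) (sq_nonneg ‖f n‖)
    have : 0 < 1 - r := by linarith
    gcongr
  · have hz : (z : ℂ) ∈ ball (0 : ℂ) 1 := mem_ball_zero_iff.2 z.norm_lt_one
    have hsum : Summable fun n => (c n : ℂ) * G n z :=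
      Summable.of_norm_bounded (hs.mul_left _) fun n => hle n z hz
    have hre := Complex.hasSum_re hsum.hasSum
    simp only [Complex.re_ofReal_mul] at hre
    have hterm : ∀ n, c n * ‖f n z‖ ^ 2 ≤ c n * (G n z).re := fun n => by
      rw [H2.apply_eq_tsum]
      exact mul_le_mul_of_nonneg_left (hG n z hz).2 (hc n)
    rw [Complex.add_re, Complex.one_re, ← hre.tsum_eq]
    exact add_le_add le_rfl (Summable.tsum_le_tsum hterm (hre.summable.of_nonneg_of_le
      (fun n => mul_nonneg (hc n) (sq_nonneg _)) hterm) hre.summable)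

/-- An analytic weight dominated by `1 - |φ|²` gives a Hilbert-Schmidt weighted composition
operator. -/
theorem exists_isHilbertSchmidt_of_norm_le {φ : 𝔻 → 𝔻} (hφ : IsAnalytic fun z => (φ z : ℂ))
    {W : ℂ → ℂ} (hW : DifferentiableOn ℂ W (ball 0 1))
    (hle : ∀ z : 𝔻, ‖W z‖ ≤ 1 - ‖(φ z : ℂ)‖ ^ 2) {z₀ : 𝔻} (hz₀ : W z₀ ≠ 0) :
    ∃ w : H2, w ≠ 0 ∧ ∃ T : H2 →L[ℂ] H2, IsWeightedComposition w φ T ∧ IsHilbertSchmidt T := by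
  obtain ⟨Φ, hΦd, hΦ⟩ : ∃ Φ : ℂ → ℂ, DifferentiableOn ℂ Φ (ball 0 1) ∧ ∀ z : 𝔻, (φ z : ℂ) = Φ z :=
    hφ
  have hlift : ∀ z ∈ ball (0 : ℂ) 1, ∃ u : 𝔻, (u : ℂ) = z := fun z hz =>
    ⟨Complex.UnitDisc.mk z (mem_ball_zero_iff.1 hz), rfl⟩
  have hΦmaps : Set.MapsTo Φ (ball 0 1) (ball 0 1) := fun z hz => by
    obtain ⟨u, rfl⟩ := hlift z hz
    rw [← hΦ]
    exact mem_ball_zero_iff.2 (φ u).norm_lt_one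
  obtain ⟨w, hw, -⟩ := exists_H2_of_norm_le hW (C := 1) fun z hz => by
    obtain ⟨u, rfl⟩ := hlift z hz
    exact (hle u).trans (sub_le_self _ (sq_nonneg _))
  -- `|f(φ)| ≤ ‖f‖/(1 - |φ|)` and `|W| ≤ (1 - |φ|)(1 + |φ|)`, so `W · (f ∘ φ)` is bounded by `2‖f‖`
  -- and lies in `H²`.
  have hcomp : ∀ f : H2, ∃ g : H2, (∀ z : 𝔻, g z = w z * f (φ z)) ∧ ‖g‖ ≤ 2 * ‖f‖ := fun f => by
    obtain ⟨g, hg, hgle⟩ := exists_H2_of_norm_le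
      (hW.mul ((H2.coeffs f).differentiableOn.comp hΦd hΦmaps)) (C := 2 * ‖f‖) fun z hz => by
        obtain ⟨u, rfl⟩ := hlift z hz
        have h1 := (H2.coeffs f).norm_tsum_le (hΦmaps hz)
        have h2 := hle u
        have h3 : (0 : ℝ) < 1 - ‖Φ u‖ := by linarith [mem_ball_zero_iff.1 (hΦmaps hz)]
        rw [hΦ] at h2
        rw [H2.norm_coeffs] at h1
        simp only [Pi.mul_apply, Function.comp_apply, norm_mul]
        calc _ ≤ (1 - ‖Φ u‖ ^ 2) * (‖f‖ * (1 - ‖Φ u‖)⁻¹) :=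
              mul_le_mul h2 h1 (norm_nonneg _) ((norm_nonneg _).trans h2)
          _ = (1 + ‖Φ u‖) * ‖f‖ := by field_simp; ring
          _ ≤ 2 * ‖f‖ := by gcongr; linarith
    refine ⟨g, fun z => ?_, hgle⟩
    rw [hg, hw, H2.apply_eq_tsum, hΦ]
    rfl
  choose t ht htle using hcomp
  let T : H2 →L[ℂ] H2 := LinearMap.mkContinuous
    { toFun := t
      map_add' := fun f g => H2.ext fun z => by
        have h1 : (t f + t g) z = t f z + t g z := rfl
        have h2 : (f + g) (φ z) = f (φ z) + g (φ z) := rfl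
        rw [ht, h1, h2, ht, ht, mul_add]
      map_smul' := fun a f => H2.ext fun z => by
        have h1 : (a • t f) z = a * t f z := rfl
        have h2 : (a • f) (φ z) = a * f (φ z) := rfl
        rw [RingHom.id_apply, ht, h1, h2, ht, mul_left_comm] } 2 htle
  have hT : IsWeightedComposition w φ T := ht
  refine ⟨w, ?_, T, hT, isHilbertSchmidt_of_tsum_ne_top monomialBasis T ?_⟩
  · rintro rfl
    exact hz₀ (hw z₀).symm
  · refine ne_top_of_le_ne_top ENNReal.one_ne_top ?_
    rw [ENNReal.tsum_eq_iSup_sum]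
    refine iSup_le fun s => ?_
    simp_rw [enorm_sq_eq_ofReal]
    rw [← ENNReal.ofReal_sum_of_nonneg fun _ _ => sq_nonneg _, ← ENNReal.ofReal_one]
    refine ENNReal.ofReal_le_ofReal (sum_norm_sq_le s _ fun z => ?_)
    set x := ‖(φ z : ℂ)‖ ^ 2 with hx
    have hx1 : x < 1 := pow_lt_one₀ (norm_nonneg _) (φ z).norm_lt_one two_ne_zero
    have hterm : ∀ n, ‖T (monomialBasis n) z‖ ^ 2 = ‖W z‖ ^ 2 * x ^ n := fun n => by
      rw [hT, monomialBasis_apply, hw, norm_mul, norm_pow, mul_pow, hx, ← pow_mul, ← pow_mul,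
        mul_comm n]
    have hgeom := hasSum_geometric_of_lt_one (sq_nonneg _) hx1
    simp_rw [hterm, ← Finset.mul_sum]
    calc _ ≤ (1 - x) ^ 2 * (1 - x)⁻¹ := by
          gcongr
          · exact hle z
          · exact sum_le_hasSum s (fun n _ => pow_nonneg (sq_nonneg _) n) hgeom
      _ = 1 - x := by have := (sub_pos.2 hx1).ne'; field_simp
      _ ≤ 1 := sub_le_self _ (sq_nonneg _)

end HardyWeighted

end

theorem mainTheorem9 (φ : Complex.UnitDisc → Complex.UnitDisc)
    (hφ : HardyWeighted.IsAnalytic (fun z => (φ z : ℂ)))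
    (p : ℝ) (hp : 0 < p)
    (h : ∃ w : HardyWeighted.H2, w ≠ 0 ∧ ∃ T : HardyWeighted.H2 →L[ℂ] HardyWeighted.H2,
      HardyWeighted.IsWeightedComposition w φ T ∧ HardyWeighted.IsSchatten p T) :
    ∃ w' : HardyWeighted.H2, w' ≠ 0 ∧ ∃ T' : HardyWeighted.H2 →L[ℂ] HardyWeighted.H2,
      HardyWeighted.IsWeightedComposition w' φ T' ∧ HardyWeighted.IsHilbertSchmidt T' := by
  open HardyWeighted in
  obtain ⟨w, hw, T, hT, hTp⟩ := h
  obtain ⟨k, hk, hsum⟩ := hTp.exists_tsum_enorm_pow_ne_top monomialBasis.orthonormal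
  have hk' : (2 : ℝ) ≤ k := by exact_mod_cast hk
  have hs : Summable fun n => (‖T (monomialBasis n)‖ ^ 2) ^ k := by
    simpa using ENNReal.summable_toReal hsum
  obtain ⟨F, hF, hle⟩ := exists_analytic_majorant_tsum (fun n => T (monomialBasis n))
    (fun n => by positivity) (summable_weight_mul hk (fun n => sq_nonneg _) hs)
  have hF1 : ∀ z : Complex.UnitDisc, 1 ≤ (F z).re := fun z =>
    le_trans (le_add_of_nonneg_right (tsum_nonneg fun n => by positivity)) (hle z)
  have hF0 : ∀ z ∈ Metric.ball (0 : ℂ) 1, F z ≠ 0 := fun z hz h0 => by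
    have := hF1 (Complex.UnitDisc.mk z (mem_ball_zero_iff.1 hz))
    rw [Complex.UnitDisc.coe_mk, h0, Complex.zero_re] at this
    linarith
  obtain ⟨z₀, hz₀⟩ : ∃ z₀, w z₀ ≠ 0 := by
    by_contra! hcon
    exact hw (H2.ext hcon)
  refine exists_isHilbertSchmidt_of_norm_le hφ
    -- The power `2k` turns the bound `|w²/F| ≤ (1 - |φ|²)^(1/(2k))` into `|W| ≤ 1 - |φ|²`.
    (W := fun z => ((∑' n, H2.coeffs w n * z ^ n) ^ 2 / F z) ^ (2 * k))
    ((((H2.coeffs w).differentiableOn.pow 2).div hF hF0).pow _) (fun z => ?_) (z₀ := z₀) ?_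
  · set x := ‖(φ z : ℂ)‖ ^ 2 with hx
    have hx1 : x < 1 := pow_lt_one₀ (norm_nonneg _) (φ z).norm_lt_one two_ne_zero
    have hy : 0 < 1 - x := sub_pos.2 hx1
    have hterm : ∀ n, ‖T (monomialBasis n) z‖ ^ 2 = ‖w z‖ ^ 2 * x ^ n := fun n => by
      rw [hT, monomialBasis_apply, norm_mul, norm_pow, mul_pow, hx, ← pow_mul, ← pow_mul,
        mul_comm n]
    have hk1 : 0 < 1 / (2 * k : ℝ) := by positivity
    have hk2 : 1 / (2 * k : ℝ) < 1 := by rw [div_lt_one (by positivity)]; linarith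
    have hlow := rpow_sub_one_le_tsum (sq_nonneg _) hx1 (β := 1 - 1 / (2 * k : ℝ))
      (by linarith) (by linarith)
    have h1 : 1 + ‖w z‖ ^ 2 * ∑' n : ℕ, ((n : ℝ) + 1) ^ (-(1 - 1 / (2 * k : ℝ))) * x ^ n ≤
        (F z).re := by
      rw [← tsum_mul_left]
      refine le_of_eq_of_le (congrArg (1 + ·) (tsum_congr fun n => ?_)) (hle z)
      rw [hterm, mul_left_comm]
    have h2 : ‖w z‖ ^ 2 * (1 - x) ^ (1 - 1 / (2 * k : ℝ) - 1) ≤ ‖F z‖ := by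
      have h3 := mul_le_mul_of_nonneg_left hlow (sq_nonneg ‖w z‖)
      have h4 := Complex.re_le_norm (F z)
      linarith
    have h5 : ‖w z‖ ^ 2 / ‖F z‖ ≤ (1 - x) ^ (1 / (2 * k : ℝ)) := by
      have hFpos : 0 < ‖F z‖ := norm_pos_iff.2 (hF0 z (mem_ball_zero_iff.2 z.norm_lt_one))
      rw [div_le_iff₀ hFpos]
      calc ‖w z‖ ^ 2 = (1 - x) ^ (1 / (2 * k : ℝ)) *
            (‖w z‖ ^ 2 * (1 - x) ^ (1 - 1 / (2 * k : ℝ) - 1)) := by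
            rw [mul_left_comm, ← Real.rpow_add hy]
            simp
        _ ≤ _ := by gcongr
    rw [← H2.apply_eq_tsum, norm_pow, norm_div, norm_pow]
    calc _ ≤ ((1 - x) ^ (1 / (2 * k : ℝ))) ^ (2 * k) := by gcongr
      _ = 1 - x := by
        rw [← Real.rpow_natCast, ← Real.rpow_mul hy.le]
        push_cast
        rw [one_div_mul_cancel (by positivity), Real.rpow_one]
  · rw [← H2.apply_eq_tsum]
    exact pow_ne_zero _ (div_ne_zero (pow_ne_zero _ hz₀)
      (hF0 _ (mem_ball_zero_iff.2 z₀.norm_lt_one)))
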